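/- Let $e>2$ be an integer. Conventions. For a partition $\lambda$ write $\lambda=(\lambda_1\ge\lambda_2\ge\dots)$ with $\lambda_i=0$ beyond the last part, $\lambda'$ for the conjugate partition; $\lambda$ is $e$-regular if it has no $e$ equal positive parts. The rim of $\lambda$ is the set of boxes $(i,j)$ of its Young diagram such that $(i+1,j+1)$ is not in the diagram. The $e$-rim is obtained by traversing the rim from $(1,\lambda_1)$ and repeating: include the next $e$ boxes (or all remaining ones, if there are fewer than $e$), then move to the rightmost box of the next row (or stop if there is no next row). Mullineux map. Let $\lambda^{(0)}=\lambda$ and let $\lambda^{(i+1)}$ be obtained from $\lambda^{(i)}$ by removing its $e$-rim. Let $A_i$ be the size of the $e$-rim of $\lambda^{(i)}$ and $R_i$ the number of parts of $\lambda^{(i)}$. For an $e$-regular partition $\lambda$, $m_e(\lambda)$ is the $e$-regular partition $\mu$ for which the corresponding numbers are $A_i$ and $A_i-R_i+\varepsilon_i$ for all $i\ge 0$, where $\varepsilon_i=0$ if $e\mid A_i$ and $\varepsilon_i=1$ otherwise. $\beta$-sets. A $\beta$-set of a partition $\lambda$ is a set $B_s(\lambda)=\{\lambda_i-i+s : i\ge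 1\}\subset\mathbb Z$ with $s\in\mathbb Z$; it is canonical if $s=0$. The leading beads of a $\beta$-set $B$ are $b_0=\max B$ and $b_{i+1}=\max\{b\in B: b\le b_i-e\}$ for $i\ge 0$. The stable index $z$ is the least index from which the sequence $(b_i+ie)_{i\ge 0}$ is constant. Put $$M_e(B)=\bigl(B\setminus\{b_i: i\ge 0\}\bigr)\cup\{b_i-e : i\ge 0\},\qquad ms_e(B)=b_z+ze .$$ Abacus Mullineux Algorithm. Given a $\beta$-set $B$ of an $e$-regular partition, start with $S=B$ and $T=\varnothing$, and repeat: if $S$ is a $\beta$-set of the empty partition, return $T\cup S$ and terminate; otherwise add $ms_e(S)$ to $T$ and then replace $S$ by $M_e(S)$ (with the same old $S$ in both). Proposition. Let $\lambda$ be an $e$-regular partition. Then $m_e(\lambda)$ is well defined (exactly one partition $\mu$ as above exists), and the Abacus Mullineux Algorithm, started from any $\beta$-set $B$ of $\lambda$, terminates after finitely many steps and returns a $\beta$-set of $m_e(\lambda)'$. Moreover, if $B$ is the canonical $\beta$-set of $\lambda$, then the returned set is the canonical $\beta$-set of $m_e(\lambda)'$. -/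

import Mathlib

/-! Partitions are Young diagrams `μ : YoungDiagram`: `μ.rowLen i` is the part with index `i + 1`
(rows are counted from `0`), `μ.colLen 0` is the number of parts, `μ.card` the size,
`μ.transpose` the conjugate partition and `⊥` the empty partition. -/

namespace AbacusMullineux

/-- A partition is `e`-regular if it has no `e` equal (positive) parts. -/
def IsRegular (e : ℕ) (μ : YoungDiagram) : Prop :=
  ∀ k : ℕ, μ.rowLens.count k < e

/-! ### The `e`-rim and the Mullineux map -/

/-- The number of boxes of the rim in row `i`. The rim consists of the boxes `(i, j)` of the diagram
such that `(i + 1, j + 1)` is not a box. -/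
def rimRow (μ : YoungDiagram) (i : ℕ) : ℕ :=
  ((μ.row i).filter fun c => (c.1 + 1, c.2 + 1) ∉ μ).card

/-- The rim is traversed from the end of the first row, and cut into segments of `e` boxes. When a
segment is complete, the traversal moves to the rightmost box of the next row. Hence every row is
entered at its rightmost box; `segmentLeft e μ i` is the number of boxes that the current segment
still lacks when row `i` is entered. -/
def segmentLeft (e : ℕ) (μ : YoungDiagram) : ℕ → ℕ
  | 0 => e
  | i + 1 =>
    if segmentLeft e μ i ≤ rimRow μ i then e else segmentLeft e μ i - rimRow μ i

/-- The `e`-rim: in row `i` it consists of the rightmost `segmentLeft e μ i` boxes, or of all rim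
boxes of the row if there are fewer of them. -/
def eRim (e : ℕ) (μ : YoungDiagram) : Finset (ℕ × ℕ) :=
  μ.cells.filter fun c => μ.rowLen c.1 ≤ c.2 + min (segmentLeft e μ c.1) (rimRow μ c.1)

theorem rimRow_eq (μ : YoungDiagram) (i : ℕ) :
    rimRow μ i = μ.rowLen i - (μ.rowLen (i + 1) - 1) := by
  have : ((μ.row i).filter fun c => (c.1 + 1, c.2 + 1) ∉ μ) =
      {i} ×ˢ Finset.Ico (μ.rowLen (i + 1) - 1) (μ.rowLen i) := by
    ext ⟨a, b⟩
    simp only [Finset.mem_filter, YoungDiagram.mem_row_iff, YoungDiagram.mem_iff_lt_rowLen,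
      Finset.mem_product, Finset.mem_singleton, Finset.mem_Ico]
    constructor
    · rintro ⟨⟨h1, rfl⟩, h2⟩
      exact ⟨rfl, by omega, h1⟩
    · rintro ⟨rfl, h1, h2⟩
      exact ⟨⟨h2, rfl⟩, by omega⟩
  rw [rimRow, this]
  simp

theorem segmentLeft_pos (e : ℕ) [NeZero e] (μ : YoungDiagram) (i : ℕ) :
    0 < segmentLeft e μ i := by
  have he : 0 < e := Nat.pos_of_ne_zero (NeZero.ne e)
  cases i with
  | zero => exact he
  | succ i =>
    rw [segmentLeft]
    split_ifs <;> omega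

/-- The partition obtained by removing the `e`-rim. -/
def removeERim (e : ℕ) [NeZero e] (μ : YoungDiagram) : YoungDiagram where
  cells := μ.cells \ eRim e μ
  isLowerSet := by
    have key : ∀ i, μ.rowLen (i + 1) - min (segmentLeft e μ (i + 1)) (rimRow μ (i + 1)) ≤
        μ.rowLen i - min (segmentLeft e μ i) (rimRow μ i) := by
      intro i
      have h1 := segmentLeft_pos e μ (i + 1)
      have h2 := rimRow_eq μ i
      have h3 := rimRow_eq μ (i + 1)
      have h4 := μ.rowLen_anti i (i + 1) (by omega)
      have h5 := μ.rowLen_anti (i + 1) (i + 1 + 1) (by omega)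
      omega
    have anti : Antitone fun i =>
        μ.rowLen i - min (segmentLeft e μ i) (rimRow μ i) := antitone_nat_of_succ_le key
    have hmem : ∀ c : ℕ × ℕ, c ∈ μ.cells \ eRim e μ ↔
        c.2 < μ.rowLen c.1 - min (segmentLeft e μ c.1) (rimRow μ c.1) := by
      rintro ⟨i, j⟩
      simp only [eRim, Finset.mem_sdiff, Finset.mem_filter, YoungDiagram.mem_cells,
        YoungDiagram.mem_iff_lt_rowLen]
      omega
    intro c d hdc hc
    rw [Finset.mem_coe, hmem] at hc ⊢
    have h6 := anti hdc.1
    have h7 := hdc.2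
    simp only at h6
    omega

/-- `rimSize e μ i` and `rimLength e μ i` are the entries `Aᵢ` and `Rᵢ` of the Mullineux symbol
of `μ`: the size of the `e`-rim and the number of parts of the partition `μ⁽ⁱ⁾` that is obtained
from `μ` by removing the `e`-rim `i` times. Both are `0` as soon as `μ⁽ⁱ⁾` is empty. -/
def rimSize (e : ℕ) [NeZero e] (μ : YoungDiagram) (i : ℕ) : ℕ :=
  (eRim e ((removeERim e)^[i] μ)).card

/-- The entry `Rᵢ` of the Mullineux symbol, see `rimSize`. -/
def rimLength (e : ℕ) [NeZero e] (μ : YoungDiagram) (i : ℕ) : ℕ :=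
  ((removeERim e)^[i] μ).colLen 0

/-- `μ` is the image of `lam` under the Mullineux map: it is the `e`-regular partition whose
Mullineux symbol has the same entries `Aᵢ` and the entries `Aᵢ - Rᵢ + εᵢ` in place of `Rᵢ`,
where `εᵢ` is `0` if `e` divides `Aᵢ`, and `1` otherwise. -/
def IsMullineuxImage (e : ℕ) [NeZero e] (lam μ : YoungDiagram) : Prop :=
  IsRegular e μ ∧
    ∀ i, rimSize e μ i = rimSize e lam i ∧
      (rimLength e μ i : ℤ) =
        rimSize e lam i - rimLength e lam i + (if e ∣ rimSize e lam i then 0 else 1)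

/-- The Mullineux map `mₑ`. -/
noncomputable def mullineux (e : ℕ) [NeZero e] (lam : YoungDiagram) : YoungDiagram :=
  Classical.epsilon (IsMullineuxImage e lam)

/-! ### `β`-sets and leading beads -/

/-- The `β`-set `B_s(μ) = {μᵢ - i + s : i ≥ 1}`. -/
def betaSet (s : ℤ) (μ : YoungDiagram) : Set ℤ :=
  Set.range fun i : ℕ => (μ.rowLen i : ℤ) - (i + 1) + s

/-- `B` is a `β`-set of the partition `μ`. The canonical one is `betaSet 0 μ`. -/
def IsBetaSet (B : Set ℤ) (μ : YoungDiagram) : Prop :=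
  ∃ s : ℤ, B = betaSet s μ

/-- The leading beads `b₀, b₁, …` of `B`: `b₀` is the greatest bead, and `bᵢ₊₁` is the greatest
bead that is at most `bᵢ - e`. -/
noncomputable def leadingBead (e : ℕ) (B : Set ℤ) : ℕ → ℤ
  | 0 => sSup B
  | i + 1 => sSup {x | x ∈ B ∧ x ≤ leadingBead e B i - e}

/-- The stable index: the least `i` from which the sequence `bᵢ + i e` is constant. -/
noncomputable def stableIndex (e : ℕ) (B : Set ℤ) : ℕ :=
  sInf {i : ℕ | ∀ j, i ≤ j →
    leadingBead e B j + (j : ℤ) * e = leadingBead e B i + (i : ℤ) * e}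

/-- `Mₑ(B)`: every leading bead `bᵢ` is replaced by `bᵢ - e`. -/
def Ms (e : ℕ) (B : Set ℤ) : Set ℤ :=
  (B \ Set.range (leadingBead e B)) ∪ Set.range fun i => leadingBead e B i - e

/-- `msₑ(B) = b_z + z e`, where `z` is the stable index. -/
noncomputable def ms (e : ℕ) (B : Set ℤ) : ℤ :=
  leadingBead e B (stableIndex e B) + (stableIndex e B : ℤ) * e

/-- `Returns e S T R`: the loop of the Abacus Mullineux Algorithm, entered with the sets `S` and
`T`, terminates (after finitely many rounds) and returns the set `R`. -/
inductive Returns (e : ℕ) : Set ℤ → Set ℤ → Set ℤ → Prop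
  | done (S T : Set ℤ) : IsBetaSet S ⊥ → Returns e S T (T ∪ S)
  | step (S T R : Set ℤ) : ¬ IsBetaSet S ⊥ →
      Returns e (Ms e S) (insert (ms e S) T) R → Returns e S T R

/-- The algorithm is deterministic. -/
theorem Returns.unique {e : ℕ} {S T R R' : Set ℤ} (h : Returns e S T R)
    (h' : Returns e S T R') : R = R' := by
  induction h with
  | done S T hS =>
    cases h' with
    | done _ _ _ => rfl
    | step _ _ _ hn _ => exact absurd hS hn
  | step S T R hn _ ih =>
    cases h' with
    | done _ _ hS => exact absurd hS hn
    | step _ _ _ _ h2 => exact ih h2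

/-- The suprema in the definition of the leading beads are attained for every set of integers that
is bounded above and contains all sufficiently small integers, in particular for `β`-sets. -/
theorem leadingBead_isGreatest (e : ℕ) {B : Set ℤ} (hB : BddAbove B)
    (hl : ∃ l : ℤ, ∀ x ≤ l, x ∈ B) :
    IsGreatest B (leadingBead e B 0) ∧
      ∀ i, IsGreatest {x | x ∈ B ∧ x ≤ leadingBead e B i - e} (leadingBead e B (i + 1)) := by
  obtain ⟨l, hl⟩ := hl
  refine ⟨⟨Int.csSup_mem ⟨l, hl l le_rfl⟩ hB, fun x hx => le_csSup hB hx⟩, fun i => ?_⟩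
  have hb : BddAbove {x | x ∈ B ∧ x ≤ leadingBead e B i - e} := hB.mono fun x hx => hx.1
  exact ⟨Int.csSup_mem ⟨min l (leadingBead e B i - e), hl _ (min_le_left _ _),
    min_le_right _ _⟩ hb, fun x hx => le_csSup hb hx⟩

end AbacusMullineux

namespace AbacusMullineux

open Finset

/-! ### Young diagrams from row lengths -/

/-! Besides the `e`-rim removal I (`removeERim`) there are two coarser operations: C removes the
first column and J (`removeTruncatedERim`) removes the truncated `e`-rim, one box fewer per row than
the segments of the rim. They commute and I = CJ (`removeERim_eq`,
`removeTruncatedERim_removeColumn`).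

On the abacus J is one round of the algorithm: `Ms` turns the β-set of μ with shift s into that of
Jμ with shift s - 1, and `ms` is |μ| - |Jμ| - 1 + s (`Ms_betaSet`, `ms_betaSet`). So the algorithm
outputs the β-set, with the original shift, of the partition whose parts are the numbers of boxes
removed by successive applications of J. Let Xμ be the conjugate of that partition
(`truncatedMullineux`).

It remains to see that X is the Mullineux map. By construction CX = XJ, and an induction on size
gives JX = XC on `e`-regular partitions (`removeTruncatedERim_truncatedMullineux`). Hence X commutes
with I; it also preserves size, so it preserves all A_i. Its first column is |μ| - |Jμ| = A_0 - R_0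
+ ε_0, so Xμ has the required symbol. The two relations also make X an involution, which yields that
an `e`-regular partition is determined by its symbol, and with it uniqueness. -/

/-- The Young diagram with row lengths `f`. -/
noncomputable def ofRows (f : ℕ → ℕ) (hf : Antitone f) (h : ∃ n, f n = 0) : YoungDiagram where
  cells := (range h.choose ×ˢ range (f 0)).filter fun c => c.2 < f c.1
  isLowerSet := by
    rintro ⟨i, j⟩ ⟨k, l⟩ ⟨hk, hl⟩ hc
    simp only [coe_filter, mem_product, mem_range, Set.mem_ofPred_eq] at hc hk hl ⊢
    have h1 := hf hk
    omega

theorem rowLen_ofRows (f : ℕ → ℕ) (hf : Antitone f) (h : ∃ n, f n = 0) (i : ℕ) :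
    (ofRows f hf h).rowLen i = f i := by
  have key : ∀ j, j < (ofRows f hf h).rowLen i ↔ j < f i := by
    intro j
    rw [← YoungDiagram.mem_iff_lt_rowLen, ← YoungDiagram.mem_cells]
    simp only [ofRows, mem_filter, mem_product, mem_range, and_iff_right_iff_imp]
    intro hj
    refine ⟨?_, hj.trans_le (hf (Nat.zero_le i))⟩
    by_contra hi
    have h1 := hf (not_lt.mp hi)
    have h2 := h.choose_spec
    omega
  exact le_antisymm (le_of_not_gt fun h1 => lt_irrefl _ ((key _).1 h1))
    (le_of_not_gt fun h1 => lt_irrefl _ ((key _).2 h1))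

theorem ext_rowLen {μ ν : YoungDiagram} (h : ∀ i, μ.rowLen i = ν.rowLen i) : μ = ν := by
  ext ⟨i, j⟩
  simp only [YoungDiagram.mem_cells, YoungDiagram.mem_iff_lt_rowLen, h]

theorem ext_colLen {μ ν : YoungDiagram} (h : ∀ i, μ.colLen i = ν.colLen i) : μ = ν := by
  ext ⟨i, j⟩
  simp only [YoungDiagram.mem_cells, YoungDiagram.mem_iff_lt_colLen, h]

theorem lt_colLen_iff (μ : YoungDiagram) (i j : ℕ) : i < μ.colLen j ↔ j < μ.rowLen i := by
  rw [← YoungDiagram.mem_iff_lt_colLen, YoungDiagram.mem_iff_lt_rowLen]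

theorem rowLen_bot (i : ℕ) : (⊥ : YoungDiagram).rowLen i = 0 := by
  by_contra h
  exact YoungDiagram.notMem_bot (i, 0)
    (YoungDiagram.mem_iff_lt_rowLen.2 (Nat.pos_of_ne_zero h))

theorem eq_bot_of_rowLen_zero {μ : YoungDiagram} (h : μ.rowLen 0 = 0) : μ = ⊥ :=
  ext_rowLen fun i => by
    have := μ.rowLen_anti 0 i (Nat.zero_le i)
    rw [rowLen_bot]
    omega

theorem rowLen_of_colLen_le (μ : YoungDiagram) {i : ℕ} (h : μ.colLen 0 ≤ i) :
    μ.rowLen i = 0 := by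
  have := lt_colLen_iff μ i 0
  omega

theorem card_eq_sum_rowLen (μ : YoungDiagram) {n : ℕ} (h : μ.rowLen n = 0) :
    μ.card = ∑ i ∈ range n, μ.rowLen i := by
  rw [YoungDiagram.card, card_eq_sum_card_fiberwise (f := Prod.fst) (t := range n)]
  · refine sum_congr rfl fun i _ => ?_
    rw [YoungDiagram.rowLen_eq_card]
    rfl
  · rintro ⟨i, j⟩ hc
    simp only [coe_range, Set.mem_Iio]
    by_contra hi
    have h1 := μ.rowLen_anti n i (not_lt.mp hi)
    have h2 := YoungDiagram.mem_iff_lt_rowLen.1 ((YoungDiagram.mem_cells _).1 hc)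
    omega

/-! ### Regularity in terms of rows and of columns -/

theorem count_rowLens (μ : YoungDiagram) (k : ℕ) :
    μ.rowLens.count (k + 1) = μ.colLen k - μ.colLen (k + 1) := by
  have h : μ.rowLens.count (k + 1) =
      ((range (μ.colLen 0)).filter fun i => k + 1 = μ.rowLen i).card := by
    rw [← Multiset.coe_count]
    exact Multiset.count_map μ.rowLen (Multiset.range (μ.colLen 0)) (k + 1)
  rw [h, ← Nat.card_Ico]
  congr 1
  ext i
  have h1 := lt_colLen_iff μ i 0
  have h2 := lt_colLen_iff μ i k
  have h3 := lt_colLen_iff μ i (k + 1)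
  simp only [mem_filter, mem_range, mem_Ico]
  omega

theorem isRegular_iff_colLen {e : ℕ} (he : 0 < e) (μ : YoungDiagram) :
    IsRegular e μ ↔ ∀ j, μ.colLen j < μ.colLen (j + 1) + e := by
  constructor
  · intro h j
    have h1 := h (j + 1)
    rw [count_rowLens] at h1
    omega
  · rintro h (_ | k)
    · rwa [List.count_eq_zero.2 fun h0 => lt_irrefl _ (μ.pos_of_mem_rowLens 0 h0)]
    · have h1 := h k
      rw [count_rowLens]
      omega

theorem isRegular_iff {e : ℕ} (he : 0 < e) (μ : YoungDiagram) :
    IsRegular e μ ↔ ∀ i, 0 < μ.rowLen i → μ.rowLen (i + (e - 1)) < μ.rowLen i := by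
  rw [isRegular_iff_colLen he]
  constructor
  · intro h i hi
    by_contra! hj
    -- If rows i, ..., i + e - 1 share the length l > 0, then columns l - 1 and l differ by at least
    -- e.
    have h1 := h (μ.rowLen i - 1)
    have h2 := lt_colLen_iff μ (i + (e - 1)) (μ.rowLen i - 1)
    have h3 := lt_colLen_iff μ i (μ.rowLen i - 1 + 1)
    omega
  · intro h j
    by_contra! hj
    -- A block of e rows of length j + 1 would start at row `μ.colLen (j + 1)`.
    have h1 := h (μ.colLen (j + 1))
    have h2 := lt_colLen_iff μ (μ.colLen (j + 1) + (e - 1)) j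
    have h3 := lt_colLen_iff μ (μ.colLen (j + 1)) (j + 1)
    have h4 := lt_colLen_iff μ (μ.colLen (j + 1)) j
    omega

/-! ### Removing the first column and the truncated `e`-rim -/

/-- The partition obtained by removing the first column. -/
noncomputable def removeColumn (μ : YoungDiagram) : YoungDiagram :=
  ofRows (fun i => μ.rowLen i - 1)
    (fun i j h => Nat.sub_le_sub_right (μ.rowLen_anti i j h) 1)
    ⟨μ.colLen 0, by simp [rowLen_of_colLen_le]⟩

@[simp]
theorem rowLen_removeColumn (μ : YoungDiagram) (i : ℕ) :
    (removeColumn μ).rowLen i = μ.rowLen i - 1 := rowLen_ofRows _ _ _ _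

theorem colLen_removeColumn (μ : YoungDiagram) (j : ℕ) :
    (removeColumn μ).colLen j = μ.colLen (j + 1) := by
  refine eq_of_forall_lt_iff fun i => ?_
  rw [lt_colLen_iff, lt_colLen_iff, rowLen_removeColumn]
  omega

theorem card_removeColumn (μ : YoungDiagram) :
    (removeColumn μ).card + μ.colLen 0 = μ.card := by
  have h0 : μ.rowLen (μ.colLen 0) = 0 := rowLen_of_colLen_le μ le_rfl
  rw [card_eq_sum_rowLen μ h0, card_eq_sum_rowLen (removeColumn μ) (n := μ.colLen 0) (by simp [h0])]
  have h1 : μ.colLen 0 = ∑ i ∈ range (μ.colLen 0), 1 := by simp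
  nth_rw 2 [h1]
  rw [← sum_add_distrib]
  refine sum_congr rfl fun i hi => ?_
  have := (lt_colLen_iff μ i 0).1 (mem_range.1 hi)
  rw [rowLen_removeColumn]
  omega

theorem eq_of_removeColumn_eq {μ ν : YoungDiagram} (h : removeColumn μ = removeColumn ν)
    (h0 : μ.colLen 0 = ν.colLen 0) : μ = ν := by
  refine ext_colLen fun j => ?_
  cases j with
  | zero => exact h0
  | succ j => rw [← colLen_removeColumn, h, colLen_removeColumn]

/-- The variant of `segmentLeft` for the rim extended by one box in each row `i`, so that it has
`μ.rowLen i - μ.rowLen (i + 1) + 1` boxes in row `i` for every `i`. -/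
def gapLeft (e : ℕ) (μ : YoungDiagram) : ℕ → ℕ
  | 0 => e
  | i + 1 =>
    if gapLeft e μ i ≤ μ.rowLen i + 1 - μ.rowLen (i + 1) then e
    else gapLeft e μ i - (μ.rowLen i + 1 - μ.rowLen (i + 1))

theorem gapLeft_succ (e : ℕ) (μ : YoungDiagram) (i : ℕ) : gapLeft e μ (i + 1) =
    if gapLeft e μ i ≤ μ.rowLen i + 1 - μ.rowLen (i + 1) then e
    else gapLeft e μ i - (μ.rowLen i + 1 - μ.rowLen (i + 1)) := rfl

theorem gapLeft_pos (e : ℕ) [NeZero e] (μ : YoungDiagram) (i : ℕ) : 0 < gapLeft e μ i := by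
  have he : 0 < e := Nat.pos_of_ne_zero (NeZero.ne e)
  cases i with
  | zero => exact he
  | succ i =>
    rw [gapLeft_succ]
    split_ifs <;> omega

theorem gapLeft_le (e : ℕ) (μ : YoungDiagram) (i : ℕ) : gapLeft e μ i ≤ e := by
  induction i with
  | zero => exact le_rfl
  | succ i ih =>
    rw [gapLeft_succ]
    split_ifs <;> omega

/-- The rim and the extended rim differ only from the last nonempty row on, and the recursion up to
row i uses only earlier rows. -/
theorem segmentLeft_eq_gapLeft (e : ℕ) (μ : YoungDiagram) {i : ℕ} (h : i < μ.colLen 0) :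
    segmentLeft e μ i = gapLeft e μ i := by
  induction i with
  | zero => rfl
  | succ i ih =>
    have h1 := (lt_colLen_iff μ (i + 1) 0).1 h
    rw [gapLeft_succ, segmentLeft, ih (by omega), rimRow_eq,
      show μ.rowLen i - (μ.rowLen (i + 1) - 1) = μ.rowLen i + 1 - μ.rowLen (i + 1) by omega]

theorem gapLeft_removeColumn (e : ℕ) (μ : YoungDiagram) {i : ℕ} (h : i < μ.colLen 0) :
    gapLeft e (removeColumn μ) i = gapLeft e μ i := by
  induction i with
  | zero => rfl
  | succ i ih =>
    have h1 := (lt_colLen_iff μ (i + 1) 0).1 h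
    have h2 := μ.rowLen_anti i (i + 1) (Nat.le_succ i)
    rw [gapLeft_succ, gapLeft_succ, ih (by omega)]
    simp only [rowLen_removeColumn]
    rw [show μ.rowLen i - 1 + 1 - (μ.rowLen (i + 1) - 1) = μ.rowLen i + 1 - μ.rowLen (i + 1) by
      omega]

/-- The partition obtained by removing the truncated `e`-rim. -/
noncomputable def removeTruncatedERim (e : ℕ) [NeZero e] (μ : YoungDiagram) : YoungDiagram :=
  -- Row i keeps one box more than if its whole share of the extended segment were removed; an empty
  -- row stays empty.
  ofRows (fun i => μ.rowLen i + 1 - min (gapLeft e μ i) (μ.rowLen i + 1 - μ.rowLen (i + 1)))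
    (antitone_nat_of_succ_le fun i => by
      have h1 := gapLeft_pos e μ (i + 1)
      have h2 := μ.rowLen_anti i (i + 1) (by omega)
      have h3 := μ.rowLen_anti (i + 1) (i + 1 + 1) (by omega)
      omega)
    ⟨μ.colLen 0, by
      have h1 := gapLeft_pos e μ (μ.colLen 0)
      have h2 := rowLen_of_colLen_le μ (le_refl (μ.colLen 0))
      have h3 := rowLen_of_colLen_le μ (Nat.le_succ (μ.colLen 0))
      simp only [Nat.succ_eq_add_one] at h3
      omega⟩

theorem rowLen_removeTruncatedERim (e : ℕ) [NeZero e] (μ : YoungDiagram) (i : ℕ) :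
    (removeTruncatedERim e μ).rowLen i =
      μ.rowLen i + 1 - min (gapLeft e μ i) (μ.rowLen i + 1 - μ.rowLen (i + 1)) :=
  rowLen_ofRows _ _ _ _

theorem rowLen_removeTruncatedERim_le (e : ℕ) [NeZero e] (μ : YoungDiagram) (i : ℕ) :
    (removeTruncatedERim e μ).rowLen i ≤ μ.rowLen i := by
  have h1 := gapLeft_pos e μ i
  have h2 := μ.rowLen_anti i (i + 1) (by omega)
  rw [rowLen_removeTruncatedERim]
  omega

theorem rowLen_removeERim (e : ℕ) [NeZero e] (μ : YoungDiagram) (i : ℕ) :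
    (removeERim e μ).rowLen i = μ.rowLen i - min (segmentLeft e μ i) (rimRow μ i) := by
  refine eq_of_forall_lt_iff fun j => ?_
  rw [← YoungDiagram.mem_iff_lt_rowLen, ← YoungDiagram.mem_cells]
  simp only [removeERim, eRim, mem_sdiff, mem_filter, YoungDiagram.mem_cells,
      YoungDiagram.mem_iff_lt_rowLen]
  omega

/-- The `e`-rim takes from each row one box more than the truncated one, unless the truncated one
has already emptied the row. -/
theorem removeERim_eq (e : ℕ) [NeZero e] (μ : YoungDiagram) :
    removeERim e μ = removeColumn (removeTruncatedERim e μ) := by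
  refine ext_rowLen fun i => ?_
  rw [rowLen_removeERim, rowLen_removeColumn, rowLen_removeTruncatedERim, rimRow_eq]
  have h2 := μ.rowLen_anti i (i + 1) (by omega)
  rcases lt_or_ge i (μ.colLen 0) with h | h
  · rw [segmentLeft_eq_gapLeft e μ h]
    omega
  · have := rowLen_of_colLen_le μ h
    have h1 := gapLeft_pos e μ i
    omega

theorem removeTruncatedERim_removeColumn (e : ℕ) [NeZero e] (μ : YoungDiagram) :
    removeTruncatedERim e (removeColumn μ) = removeColumn (removeTruncatedERim e μ) := by
  refine ext_rowLen fun i => ?_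
  simp only [rowLen_removeColumn, rowLen_removeTruncatedERim]
  have h2 := μ.rowLen_anti i (i + 1) (by omega)
  have h3 := (lt_colLen_iff μ i 0)
  rcases lt_or_ge i (μ.colLen 0) with h | h
  · rw [gapLeft_removeColumn e μ h]
    omega
  · have := rowLen_of_colLen_le μ h
    have h1 := gapLeft_pos e μ i
    have h4 := gapLeft_pos e (removeColumn μ) i
    omega

/-! ### Size of the `e`-rim and number of rows left by the truncated `e`-rim -/

theorem card_eRim (e : ℕ) [NeZero e] (μ : YoungDiagram) :
    (eRim e μ).card + (removeERim e μ).card = μ.card := by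
  have h : eRim e μ ⊆ μ.cells := filter_subset _ _
  have h1 := card_sdiff_add_card_eq_card h
  change (eRim e μ).card + (μ.cells \ eRim e μ).card = μ.cells.card
  omega

/-- Invariant of the traversal: completing the current segment gives a whole number of segments. -/
theorem dvd_sum_add_segmentLeft (e : ℕ) (μ : YoungDiagram) (n : ℕ) :
    e ∣ ∑ i ∈ range n, min (segmentLeft e μ i) (rimRow μ i) + segmentLeft e μ n := by
  induction n with
  | zero => simp [segmentLeft]
  | succ n ih =>
    rw [sum_range_succ, segmentLeft]
    split_ifs with h
    · rw [min_eq_left h]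
      exact dvd_add ih dvd_rfl
    · rw [min_eq_right (by omega), add_assoc, Nat.add_sub_cancel' (by omega)]
      exact ih

theorem card_eRim_eq_sum (e : ℕ) [NeZero e] (μ : YoungDiagram) :
    (eRim e μ).card = ∑ i ∈ range (μ.colLen 0), min (segmentLeft e μ i) (rimRow μ i) := by
  have h0 : μ.rowLen (μ.colLen 0) = 0 := rowLen_of_colLen_le μ le_rfl
  have h1 := card_eRim e μ
  rw [card_eq_sum_rowLen μ h0, card_eq_sum_rowLen (removeERim e μ) (n := μ.colLen 0)
    (by rw [rowLen_removeERim]; omega)] at h1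
  have h2 : ∑ i ∈ range (μ.colLen 0), μ.rowLen i =
      ∑ i ∈ range (μ.colLen 0), min (segmentLeft e μ i) (rimRow μ i) +
        ∑ i ∈ range (μ.colLen 0), (removeERim e μ).rowLen i := by
    rw [← sum_add_distrib]
    refine sum_congr rfl fun i _ => ?_
    rw [rowLen_removeERim, rimRow_eq]
    omega
  omega

/-- Every row but the last survives, as row i keeps at least `μ.rowLen (i + 1)` boxes. The last one
survives exactly when the final segment is complete, that is, when e divides the size of the
`e`-rim. -/
theorem colLen_removeTruncatedERim (e : ℕ) [NeZero e] (μ : YoungDiagram) :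
    (removeTruncatedERim e μ).colLen 0 + (if e ∣ (eRim e μ).card then 0 else 1) =
      μ.colLen 0 := by
  have hd := dvd_sum_add_segmentLeft e μ (μ.colLen 0)
  rw [← card_eRim_eq_sum] at hd
  have hJ := fun i => lt_colLen_iff (removeTruncatedERim e μ) i 0
  simp only [rowLen_removeTruncatedERim] at hJ
  rcases h : μ.colLen 0 with _ | r
  · have h0 := hJ 0
    have h1 : (eRim e μ).card = 0 := by rw [card_eRim_eq_sum, h]; simp
    have h2 := rowLen_of_colLen_le μ h.le
    have h3 := rowLen_of_colLen_le μ (h.le.trans (Nat.zero_le (0 + 1)))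
    have h4 := gapLeft_pos e μ 0
    rw [h1, if_pos (dvd_zero e)]
    omega
  · have hr := rowLen_of_colLen_le μ h.le
    have hr2 := rowLen_of_colLen_le μ (h.le.trans (Nat.le_succ _))
    simp only [Nat.succ_eq_add_one] at hr2
    have hs : (if e ∣ (eRim e μ).card then 0 else 1) =
        if gapLeft e μ r ≤ μ.rowLen r then 0 else 1 := by
      rw [h, segmentLeft, rimRow_eq, segmentLeft_eq_gapLeft e μ (by omega), hr] at hd
      simp only [Nat.zero_sub, Nat.sub_zero] at hd
      split_ifs at hd with h1
      · rw [if_pos h1, if_pos ((Nat.dvd_add_left dvd_rfl).1 hd)]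
      · rw [if_neg h1, if_neg]
        intro h2
        -- The number of boxes missing from the final segment lies strictly between 0 and e.
        have h3 := Nat.le_of_dvd (by omega) ((Nat.dvd_add_right h2).1 hd)
        have h4 := gapLeft_le e μ r
        have h5 := (lt_colLen_iff μ r 0).1 (by omega)
        omega
    rw [hs]
    have h6 := hJ (r + 1)
    have h7 := hJ r
    have h8 := gapLeft_pos e μ (r + 1)
    have h9 : r ≤ (removeTruncatedERim e μ).colLen 0 := by
      rcases r with _ | r
      · exact Nat.zero_le _
      · have h10 := hJ r
        have h11 := (lt_colLen_iff μ (r + 1) 0).1 (by omega)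
        have := μ.rowLen_anti r (r + 1) (by omega)
        omega
    split_ifs <;> omega

/-! ### The beads of a partition -/

/-- The elements of `betaSet s μ` in decreasing order. -/
def bead (s : ℤ) (μ : YoungDiagram) (i : ℕ) : ℤ := (μ.rowLen i : ℤ) - (i + 1) + s

theorem betaSet_eq_range (s : ℤ) (μ : YoungDiagram) : betaSet s μ = Set.range (bead s μ) := rfl

theorem bead_strictAnti (s : ℤ) (μ : YoungDiagram) : StrictAnti (bead s μ) :=
  strictAnti_nat_of_succ_lt fun i => by
    have := μ.rowLen_anti i (i + 1) (Nat.le_succ i)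
    simp only [bead]
    omega

theorem bddAbove_betaSet (s : ℤ) (μ : YoungDiagram) : BddAbove (betaSet s μ) := by
  refine ⟨bead s μ 0, ?_⟩
  rintro _ ⟨i, rfl⟩
  exact (bead_strictAnti s μ).antitone (Nat.zero_le i)

theorem exists_forall_le_mem_betaSet (s : ℤ) (μ : YoungDiagram) :
    ∃ l : ℤ, ∀ x ≤ l, x ∈ betaSet s μ := by
  refine ⟨s - 1 - μ.colLen 0, fun x hx => ⟨(s - 1 - x).toNat, ?_⟩⟩
  dsimp only
  rw [rowLen_of_colLen_le μ (by omega)]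
  omega

theorem betaSet_injective {s s' : ℤ} {μ μ' : YoungDiagram} (h : betaSet s μ = betaSet s' μ') :
    s = s' ∧ μ = μ' := by
  -- After negation the enumerations are strictly increasing, hence determined by their ranges.
  have h1 : (fun i => -bead s μ i) = fun i => -bead s' μ' i := by
    refine (StrictMono.range_inj (bead_strictAnti s μ).neg (bead_strictAnti s' μ').neg).1 ?_
    have h2 := congrArg (fun t : Set ℤ => Neg.neg '' t) h
    simpa only [betaSet_eq_range, ← Set.range_comp, Function.comp_def] using h2
  have h2 : ∀ i, bead s μ i = bead s' μ' i := fun i => neg_injective (congrFun h1 i)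
  have hs : s = s' := by
    have h3 := h2 (max (μ.colLen 0) (μ'.colLen 0))
    rw [bead, bead, rowLen_of_colLen_le μ (le_max_left _ _),
      rowLen_of_colLen_le μ' (le_max_right _ _)] at h3
    omega
  refine ⟨hs, ext_rowLen fun i => ?_⟩
  have h3 := h2 i
  simp only [bead] at h3
  omega

theorem isBetaSet_bot_iff (s : ℤ) (μ : YoungDiagram) : IsBetaSet (betaSet s μ) ⊥ ↔ μ = ⊥ := by
  constructor
  · rintro ⟨s', h⟩
    exact (betaSet_injective h).2
  · rintro rfl
    exact ⟨s, rfl⟩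

/-- The position at which the segment of the extended rim that passes through row `i` ends. -/
def target (e : ℕ) (s : ℤ) (μ : YoungDiagram) (i : ℕ) : ℤ := bead s μ i - gapLeft e μ i

theorem bead_succ_le_target_iff (e : ℕ) (s : ℤ) (μ : YoungDiagram) (i : ℕ) :
    bead s μ (i + 1) ≤ target e s μ i ↔ gapLeft e μ i ≤ μ.rowLen i + 1 - μ.rowLen (i + 1) := by
  have := μ.rowLen_anti i (i + 1) (Nat.le_succ i)
  simp only [target, bead]
  omega

/-- Consecutive beads differ by the number of boxes of the extended rim in a row. So a segment is
complete exactly when the next bead is at or below its target, and that bead starts the next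
segment. -/
theorem target_succ (e : ℕ) (s : ℤ) (μ : YoungDiagram) (i : ℕ) : target e s μ (i + 1) =
    if bead s μ (i + 1) ≤ target e s μ i then bead s μ (i + 1) - e else target e s μ i := by
  have := μ.rowLen_anti i (i + 1) (Nat.le_succ i)
  simp only [bead_succ_le_target_iff]
  rw [target, gapLeft_succ]
  split_ifs with h
  · rfl
  · simp only [target, bead]
    omega

theorem target_lt_bead (e : ℕ) [NeZero e] (s : ℤ) (μ : YoungDiagram) (i : ℕ) :
    target e s μ i < bead s μ i := by
  have := gapLeft_pos e μ i
  simp only [target]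
  omega

theorem bead_le_target_add (e : ℕ) (s : ℤ) (μ : YoungDiagram) (i : ℕ) :
    bead s μ i ≤ target e s μ i + e := by
  have := gapLeft_le e μ i
  simp only [target]
  omega

/-- The shift s - 1 absorbs the change of index: row i of the new partition is either cut off at the
target or equal to row i + 1 of the old one. -/
theorem bead_removeTruncatedERim (e : ℕ) [NeZero e] (s : ℤ) (μ : YoungDiagram) (i : ℕ) :
    bead (s - 1) (removeTruncatedERim e μ) i = max (target e s μ i) (bead s μ (i + 1)) := by
  have h1 := gapLeft_pos e μ i
  have h2 := μ.rowLen_anti i (i + 1) (Nat.le_succ i)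
  simp only [bead, target, rowLen_removeTruncatedERim]
  omega

theorem exists_target_add_eq_bead (e : ℕ) (s : ℤ) (μ : YoungDiagram) (i : ℕ) :
    ∃ j ≤ i, target e s μ i + e = bead s μ j := by
  induction i with
  | zero => exact ⟨0, le_rfl, by simp [target, gapLeft]⟩
  | succ i ih =>
    rw [target_succ]
    split_ifs with h
    · exact ⟨i + 1, le_rfl, by ring⟩
    · obtain ⟨j, hj, h1⟩ := ih
      exact ⟨j, hj.trans (Nat.le_succ i), h1⟩

theorem target_eq_or (e : ℕ) (s : ℤ) (μ : YoungDiagram) {i k : ℕ} (h : i ≤ k) :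
    target e s μ k = target e s μ i ∨ target e s μ k + e ≤ target e s μ i := by
  induction k, h using Nat.le_induction with
  | base => exact Or.inl rfl
  | succ k _ ih =>
    have he : (0 : ℤ) ≤ e := Int.natCast_nonneg e
    rw [target_succ]
    split_ifs with h1
    · refine Or.inr ?_
      rcases ih with ih | ih <;> linarith
    · exact ih

/-! ### Leading beads of a partition -/

/-- The number of segments of the extended rim that end before row `i`. -/
noncomputable def segmentIndex (e : ℕ) (μ : YoungDiagram) : ℕ → ℕ
  | 0 => 0
  | i + 1 => if bead 0 μ (i + 1) ≤ target e 0 μ i then segmentIndex e μ i + 1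
    else segmentIndex e μ i

theorem segmentIndex_succ (e : ℕ) (s : ℤ) (μ : YoungDiagram) (i : ℕ) :
    segmentIndex e μ (i + 1) = if bead s μ (i + 1) ≤ target e s μ i then segmentIndex e μ i + 1
      else segmentIndex e μ i := by
  simp only [segmentIndex, bead_succ_le_target_iff]

theorem segmentIndex_monotone (e : ℕ) (μ : YoungDiagram) : Monotone (segmentIndex e μ) :=
  monotone_nat_of_le_succ fun i => by
    rw [segmentIndex]
    split_ifs <;> omega

/-- Segments start at leading beads: beads 0, ..., i lie above the target of row i, so if the
segment ends there, bead i + 1 is the greatest bead at or below the target. -/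
theorem leadingBead_segmentIndex (e : ℕ) [NeZero e] (s : ℤ) (μ : YoungDiagram) (i : ℕ) :
    leadingBead e (betaSet s μ) (segmentIndex e μ i) = target e s μ i + e := by
  obtain ⟨hg0, hg⟩ := leadingBead_isGreatest e (bddAbove_betaSet s μ)
    (exists_forall_le_mem_betaSet s μ)
  induction i with
  | zero =>
    refine hg0.unique ⟨⟨0, ?_⟩, ?_⟩
    · simp [target, gapLeft, bead]
    · rintro _ ⟨i, rfl⟩
      have := (bead_strictAnti s μ).antitone (Nat.zero_le i)
      simp only [target, gapLeft, sub_add_cancel]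
      exact this
  | succ i ih =>
    rw [target_succ, segmentIndex_succ e s]
    split_ifs with h
    · refine (hg (segmentIndex e μ i)).unique ⟨⟨⟨i + 1, ?_⟩, ?_⟩, ?_⟩
      · simp [bead]
      · rw [ih]
        linarith
      · rintro _ ⟨⟨m, rfl⟩, hm⟩
        change bead s μ m ≤ _
        change bead s μ m ≤ _ at hm
        rw [ih, add_sub_cancel_right] at hm
        rw [sub_add_cancel]
        refine (bead_strictAnti s μ).antitone ?_
        by_contra hmi
        have h1 := (bead_strictAnti s μ).antitone (show m ≤ i by omega)
        have h2 := target_lt_bead e s μ i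
        linarith
    · exact ih

/-- An endless segment would have a fixed target below all later beads, but beads descend without
bound. -/
theorem exists_segment_end (e : ℕ) [NeZero e] (s : ℤ) (μ : YoungDiagram) (i : ℕ) :
    ∃ k, segmentIndex e μ k = segmentIndex e μ i ∧ bead s μ (k + 1) ≤ target e s μ k := by
  by_contra! h
  have key : ∀ n, segmentIndex e μ (i + n) = segmentIndex e μ i ∧
      target e s μ (i + n) = target e s μ i := by
    intro n
    induction n with
    | zero => exact ⟨rfl, rfl⟩
    | succ n ih =>
      have h1 := h (i + n) ih.1
      rw [← add_assoc, segmentIndex_succ e s, target_succ, if_neg h1.not_ge, if_neg h1.not_ge]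
      exact ih
  have h2 : ∀ n : ℕ, bead s μ n ≤ bead s μ 0 - n := by
    intro n
    have := μ.rowLen_anti 0 n (Nat.zero_le n)
    simp only [bead]
    omega
  set n := (bead s μ 0 - target e s μ i).toNat with hn
  have h3 := target_lt_bead e s μ (i + n)
  have h4 := h2 (i + n)
  rw [(key n).2] at h3
  push_cast at h4
  omega

theorem exists_segmentIndex_eq (e : ℕ) [NeZero e] (s : ℤ) (μ : YoungDiagram) (j : ℕ) :
    ∃ k, segmentIndex e μ k = j ∧ bead s μ (k + 1) ≤ target e s μ k := by
  induction j with
  | zero => exact exists_segment_end e s μ 0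
  | succ j ih =>
    obtain ⟨k, hk, h⟩ := ih
    have h1 := segmentIndex_succ e s μ k
    rw [if_pos h, hk] at h1
    rw [← h1]
    exact exists_segment_end e s μ (k + 1)

/-- Each row i contributes one new bead: the moved leading bead if a segment ends there, otherwise
the unmoved bead i + 1, which is not leading. -/
theorem Ms_betaSet (e : ℕ) [NeZero e] (s : ℤ) (μ : YoungDiagram) :
    Ms e (betaSet s μ) = betaSet (s - 1) (removeTruncatedERim e μ) := by
  have hanti := bead_strictAnti s μ
  have hlead := leadingBead_segmentIndex e s μ
  ext x
  rw [betaSet_eq_range (s - 1)]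
  simp only [Ms, Set.mem_union, Set.mem_sdiff, Set.mem_range, bead_removeTruncatedERim]
  constructor
  · rintro (⟨⟨i, rfl⟩, h⟩ | ⟨j, rfl⟩)
    · change ¬∃ j, _ = bead s μ i at h
      change ∃ j, _ = bead s μ i
      rcases i with _ | i
      · refine absurd ⟨segmentIndex e μ 0, ?_⟩ h
        rw [hlead]
        simp [target, gapLeft]
      · refine ⟨i, max_eq_right (le_of_not_ge fun h1 => h ⟨segmentIndex e μ (i + 1), ?_⟩)⟩
        rw [hlead, target_succ, if_pos h1, sub_add_cancel]
    · obtain ⟨k, rfl, hk⟩ := exists_segmentIndex_eq e s μ j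
      exact ⟨k, by rw [hlead, max_eq_left hk, add_sub_cancel_right]⟩
  · rintro ⟨i, rfl⟩
    rcases le_or_gt (bead s μ (i + 1)) (target e s μ i) with h | h
    · exact Or.inr ⟨segmentIndex e μ i, by rw [hlead, max_eq_left h, add_sub_cancel_right]⟩
    · refine Or.inl ⟨⟨i + 1, (max_eq_right h.le).symm⟩, ?_⟩
      rw [max_eq_right h.le]
      rintro ⟨j, hj⟩
      obtain ⟨k, rfl, -⟩ := exists_segmentIndex_eq e s μ j
      rw [hlead] at hj
      have h3 := bead_le_target_add e s μ i
      have h4 : bead s μ (i + 1) < bead s μ i := hanti (Nat.lt_succ_self i)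
      have he : (0 : ℤ) ≤ e := Int.natCast_nonneg e
      -- Bead i + 1 lies strictly between the target of row i and that target plus e, whereas
      -- distinct leading beads are at least e apart.
      rcases le_total k i with hk | hk
      · rcases target_eq_or e s μ hk with h5 | h5 <;> linarith
      · rcases target_eq_or e s μ hk with h5 | h5 <;> linarith

/-! ### The value of `ms` as a number of removed boxes -/

/-- The number of boxes of the truncated `e`-rim. -/
noncomputable def truncatedRimSize (e : ℕ) [NeZero e] (μ : YoungDiagram) : ℕ :=
  μ.card - (removeTruncatedERim e μ).card

theorem card_removeTruncatedERim_le (e : ℕ) [NeZero e] (μ : YoungDiagram) :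
    (removeTruncatedERim e μ).card ≤ μ.card := by
  have h0 : μ.rowLen (μ.colLen 0) = 0 := rowLen_of_colLen_le μ le_rfl
  have h1 := rowLen_removeTruncatedERim_le e μ (μ.colLen 0)
  rw [card_eq_sum_rowLen μ h0, card_eq_sum_rowLen (removeTruncatedERim e μ)
    (n := μ.colLen 0) (by omega)]
  exact sum_le_sum fun i _ => rowLen_removeTruncatedERim_le e μ i

theorem truncatedRimSize_add (e : ℕ) [NeZero e] (μ : YoungDiagram) :
    truncatedRimSize e μ + (removeTruncatedERim e μ).card = μ.card :=
  Nat.sub_add_cancel (card_removeTruncatedERim_le e μ)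

/-- Row i loses the distance from its old to its new bead, minus one. The sum telescopes except at
segment ends. For k past the last row it turns b_i + ie into the total number of removed boxes. -/
theorem sum_rowLen_sub (e : ℕ) [NeZero e] (s : ℤ) (μ : YoungDiagram) (k : ℕ) :
    ∑ i ∈ range k, ((μ.rowLen i : ℤ) - (removeTruncatedERim e μ).rowLen i) =
      target e s μ k + e + segmentIndex e μ k * e - bead s μ k - k := by
  induction k with
  | zero => simp [target, gapLeft, segmentIndex]
  | succ k ih =>
    have h1 := bead_removeTruncatedERim e s μ k
    have h2 : bead (s - 1) (removeTruncatedERim e μ) k =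
      (removeTruncatedERim e μ).rowLen k - (k + 1) + (s - 1) := rfl
    have h3 : bead s μ k = μ.rowLen k - (k + 1) + s := rfl
    rw [sum_range_succ, ih, target_succ, segmentIndex_succ e s]
    split_ifs with h
    · rw [max_eq_left h] at h1
      push_cast
      linarith
    · rw [max_eq_right (not_le.1 h).le] at h1
      push_cast
      linarith

theorem leadingBead_add_eq (e : ℕ) [NeZero e] (s : ℤ) (μ : YoungDiagram) {j : ℕ}
    (hj : segmentIndex e μ (μ.colLen 0) ≤ j) :
    leadingBead e (betaSet s μ) j + j * e = truncatedRimSize e μ - 1 + s := by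
  have key : ∀ k, μ.colLen 0 ≤ k →
      leadingBead e (betaSet s μ) (segmentIndex e μ k) + segmentIndex e μ k * e =
        truncatedRimSize e μ - 1 + s := by
    intro k hk
    have h0 := rowLen_of_colLen_le μ hk
    have h1 := rowLen_removeTruncatedERim_le e μ k
    have h2 := sum_rowLen_sub e s μ k
    rw [sum_sub_distrib, ← Nat.cast_sum, ← Nat.cast_sum, ← card_eq_sum_rowLen μ h0,
      ← card_eq_sum_rowLen _ (by omega), ← truncatedRimSize_add e μ, bead, h0] at h2
    rw [leadingBead_segmentIndex]
    push_cast at h2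
    linarith
  obtain ⟨k, rfl, -⟩ := exists_segmentIndex_eq e s μ j
  rcases le_total (μ.colLen 0) k with hk | hk
  · exact key k hk
  · rw [le_antisymm (segmentIndex_monotone e μ hk) hj]
    exact key _ le_rfl

theorem ms_betaSet (e : ℕ) [NeZero e] (s : ℤ) (μ : YoungDiagram) :
    ms e (betaSet s μ) = truncatedRimSize e μ - 1 + s := by
  have hne : {i : ℕ | ∀ j, i ≤ j → leadingBead e (betaSet s μ) j + (j : ℤ) * e =
      leadingBead e (betaSet s μ) i + (i : ℤ) * e}.Nonempty :=
    ⟨segmentIndex e μ (μ.colLen 0), fun j hj => by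
      rw [leadingBead_add_eq e s μ hj, leadingBead_add_eq e s μ le_rfl]⟩
  -- The stable index need not be computed: the constant value is read off at a common larger index.
  have h1 := Nat.sInf_mem hne (max (stableIndex e (betaSet s μ)) (segmentIndex e μ (μ.colLen 0)))
    (le_max_left _ _)
  rw [leadingBead_add_eq e s μ (le_max_right _ _)] at h1
  exact h1.symm

/-! ### Comparison of successive truncated `e`-rims -/

theorem leadingBead_succ_le {e : ℕ} {B : Set ℤ} (hB : BddAbove B) (hl : ∃ l : ℤ, ∀ x ≤ l, x ∈ B)
    (i : ℕ) : leadingBead e B (i + 1) ≤ leadingBead e B i - e :=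
  ((leadingBead_isGreatest e hB hl).2 i).1.2

theorem leadingBead_antitone {e : ℕ} {B : Set ℤ} (hB : BddAbove B)
    (hl : ∃ l : ℤ, ∀ x ≤ l, x ∈ B) : Antitone (leadingBead e B) :=
  antitone_nat_of_succ_le fun i =>
    (leadingBead_succ_le hB hl i).trans (sub_le_self _ (Int.natCast_nonneg e))

theorem sub_le_leadingBead_Ms {e : ℕ} {B : Set ℤ} (hB : BddAbove B)
    (hl : ∃ l : ℤ, ∀ x ≤ l, x ∈ B) (hB' : BddAbove (Ms e B))
    (hl' : ∃ l : ℤ, ∀ x ≤ l, x ∈ Ms e B) (i : ℕ) :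
    leadingBead e B i - e ≤ leadingBead e (Ms e B) i := by
  obtain ⟨hg0, hg⟩ := leadingBead_isGreatest e hB' hl'
  induction i with
  | zero => exact hg0.2 (Or.inr ⟨0, rfl⟩)
  | succ i ih =>
    refine (hg i).2 ⟨Or.inr ⟨i + 1, rfl⟩, ?_⟩
    have := leadingBead_succ_le (e := e) hB hl i
    linarith

theorem leadingBead_Ms_lt {e : ℕ} [NeZero e] {B : Set ℤ} (hB : BddAbove B)
    (hl : ∃ l : ℤ, ∀ x ≤ l, x ∈ B) (hB' : BddAbove (Ms e B))
    (hl' : ∃ l : ℤ, ∀ x ≤ l, x ∈ Ms e B) (i : ℕ) :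
    leadingBead e (Ms e B) i < leadingBead e B i := by
  have he : (0 : ℤ) < e := Int.natCast_pos.2 (Nat.pos_of_ne_zero (NeZero.ne e))
  have hanti := leadingBead_antitone (e := e) hB hl
  obtain ⟨hg0, hg⟩ := leadingBead_isGreatest e hB hl
  obtain ⟨hg0', hg'⟩ := leadingBead_isGreatest e hB' hl'
  induction i with
  | zero =>
    rcases hg0'.1 with ⟨h1, h2⟩ | ⟨j, hj⟩
    · exact lt_of_le_of_ne (hg0.2 h1) fun h3 => h2 ⟨0, h3.symm⟩
    · have := hanti (Nat.zero_le j)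
      simp only at hj
      linarith
  | succ i ih =>
    have h0 := (hg' i).1.2
    rcases (hg' i).1.1 with ⟨h1, h2⟩ | ⟨j, hj⟩
    · exact lt_of_le_of_ne ((hg i).2 ⟨h1, by linarith⟩) fun h3 => h2 ⟨i + 1, h3.symm⟩
    · simp only at hj
      -- A moved bead with j ≤ i would still be too high to be the next leading bead.
      rcases le_or_gt j i with hji | hji
      · have := hanti hji
        linarith
      · have : leadingBead e B j ≤ leadingBead e B (i + 1) := hanti hji
        linarith

/-- Let b and b' be the leading beads before and after `Ms`. The bounds b_j - e ≤ b'_j < b_j, taken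
at a j where both sequences are stable, become bounds on rim sizes. They make these sizes the column
lengths of an `e`-regular partition. -/
theorem truncatedRimSize_removeTruncatedERim (e : ℕ) [NeZero e] (μ : YoungDiagram) :
    truncatedRimSize e (removeTruncatedERim e μ) ≤ truncatedRimSize e μ ∧
      truncatedRimSize e μ < truncatedRimSize e (removeTruncatedERim e μ) + e := by
  set ν := removeTruncatedERim e μ
  obtain ⟨j, hj, hj'⟩ : ∃ j, segmentIndex e μ (μ.colLen 0) ≤ j ∧
    segmentIndex e ν (ν.colLen 0) ≤ j := ⟨_, le_max_left _ _, le_max_right _ _⟩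
  have hM := Ms_betaSet e 0 μ
  have h1 := leadingBead_add_eq e 0 μ hj
  have h2 := leadingBead_add_eq e (0 - 1) ν hj'
  have hB' := bddAbove_betaSet (0 - 1) ν
  have hl' := exists_forall_le_mem_betaSet (0 - 1) ν
  rw [← hM] at hB' hl' h2
  have h3 := leadingBead_Ms_lt (bddAbove_betaSet 0 μ) (exists_forall_le_mem_betaSet 0 μ) hB' hl' j
  have h4 := sub_le_leadingBead_Ms (bddAbove_betaSet 0 μ) (exists_forall_le_mem_betaSet 0 μ)
    hB' hl' j
  generalize (j : ℤ) * e = m at h1 h2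
  omega

/-! ### Regularity -/

theorem isRegular_removeColumn {e : ℕ} (he : 0 < e) {μ : YoungDiagram} (h : IsRegular e μ) :
    IsRegular e (removeColumn μ) := by
  rw [isRegular_iff_colLen he] at h ⊢
  intro j
  rw [colLen_removeColumn, colLen_removeColumn]
  exact h (j + 1)

/-- Suppose e equal nonempty rows appear, that is, e consecutive new beads. If none of them strictly
exceeds the following old bead, then μ has e equal rows one step lower. Otherwise only the last can,
since a gap follows such a bead; the segment ending there then forces e consecutive old beads in the
same rows. -/
theorem isRegular_removeTruncatedERim {e : ℕ} [NeZero e] {μ : YoungDiagram} (h : IsRegular e μ) :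
    IsRegular e (removeTruncatedERim e μ) := by
  have he : 0 < e := Nat.pos_of_ne_zero (NeZero.ne e)
  rw [isRegular_iff he] at h ⊢
  intro i hi
  by_contra! hle
  have hanti := bead_strictAnti 0 μ
  have hν : ∀ i, bead (-1) (removeTruncatedERim e μ) i =
      max (target e 0 μ i) (bead 0 μ (i + 1)) := bead_removeTruncatedERim e 0 μ
  set ν := removeTruncatedERim e μ
  have hrow : ∀ k < e, ν.rowLen (i + k) = ν.rowLen i := fun k hk =>
    le_antisymm (ν.rowLen_anti _ _ (by omega))
      (hle.trans (ν.rowLen_anti (i + k) (i + (e - 1)) (by omega)))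
  have hb : ∀ k < e, bead (-1) ν (i + k) = bead (-1) ν i - k := by
    intro k hk
    simp only [bead, hrow k hk]
    push_cast
    ring
  by_cases hall : ∀ k < e, target e 0 μ (i + k) ≤ bead 0 μ (i + k + 1)
  · have h1 : ∀ k < e, μ.rowLen (i + k + 1) = ν.rowLen i := by
      intro k hk
      have h2 := hν (i + k)
      rw [max_eq_right (hall k hk)] at h2
      simp only [bead, hrow k hk] at h2
      omega
    have h2 := h (i + 0 + 1) (by rw [h1 0 he]; exact hi)
    have h3 := h1 (e - 1) (by omega)
    rw [h1 0 he, show i + 0 + 1 + (e - 1) = i + (e - 1) + 1 by ring, h3] at h2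
    exact lt_irrefl _ h2
  · push Not at hall
    obtain ⟨k, hk, h1⟩ := hall
    have h2 := hν (i + k)
    rw [max_eq_left h1.le, hb k hk] at h2
    have hlast : k = e - 1 := by
      by_contra hne
      have h3 := hν (i + k + 1)
      have h4 := hb (k + 1) (by omega)
      rw [← add_assoc, h3, target_succ, if_pos h1.le] at h4
      have h5 : bead 0 μ (i + k + 1 + 1) < bead 0 μ (i + k + 1) := hanti (Nat.lt_succ_self _)
      push_cast at h4
      rcases max_choice (bead 0 μ (i + k + 1) - (e : ℤ)) (bead 0 μ (i + k + 1 + 1)) with h6 | h6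
        <;> rw [h6] at h4 <;> omega
    -- The segment starts at a bead one above new bead i, hence at some j ≤ i, so old beads i and i
    -- + e - 1 are at most e - 1 apart.
    obtain ⟨j, hj, h3⟩ := exists_target_add_eq_bead e 0 μ (i + k)
    have h4 := bead_le_target_add e 0 μ (i + k)
    have h5 : bead 0 μ (i + 1) ≤ bead (-1) ν i := by rw [hν]; exact le_max_right _ _
    have h6 : j ≤ i := by
      by_contra h7
      have := hanti.antitone (show i + 1 ≤ j by omega)
      omega
    have h7 := hanti.antitone h6
    have h8 := target_lt_bead e 0 μ (i + k)
    have h9 := h i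
    rw [← hlast] at h9
    have h10 := μ.rowLen_anti i (i + k) (by omega)
    have h11 : ν.rowLen i ≤ μ.rowLen i := rowLen_removeTruncatedERim_le e μ i
    have h12 : bead 0 μ (i + k) = μ.rowLen (i + k) - (i + k + 1) + 0 := by simp [bead]
    have h13 : bead 0 μ i = μ.rowLen i - (i + 1) + 0 := rfl
    omega

/-- If nothing is removed, every new bead is one below the old bead of its row. Within the first
segment this forces bead i + 1 to be bead i minus one, so the first e rows are equal, against
regularity. -/
theorem truncatedRimSize_pos {e : ℕ} [NeZero e] (he : 1 < e) {μ : YoungDiagram}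
    (h : IsRegular e μ) (hμ : μ ≠ ⊥) : 0 < truncatedRimSize e μ := by
  by_contra! h0
  have hcard := truncatedRimSize_add e μ
  have hle := rowLen_removeTruncatedERim_le e μ
  have hν : ∀ i, bead (-1) (removeTruncatedERim e μ) i =
      max (target e 0 μ i) (bead 0 μ (i + 1)) := bead_removeTruncatedERim e 0 μ
  have heq : removeTruncatedERim e μ = μ := by
    refine YoungDiagram.ext (eq_of_subset_of_card_le ?_ ?_)
    · rintro ⟨i, j⟩ hc
      have := hle i
      rw [YoungDiagram.mem_cells, YoungDiagram.mem_iff_lt_rowLen] at hc ⊢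
      omega
    · change μ.card ≤ (removeTruncatedERim e μ).card
      omega
  rw [heq] at hν
  have key : ∀ i < e, μ.rowLen i = μ.rowLen 0 ∧ target e 0 μ i = bead 0 μ 0 - e := by
    intro i
    induction i with
    | zero => exact fun _ => ⟨rfl, rfl⟩
    | succ i ih =>
      intro hi
      obtain ⟨h1, h2⟩ := ih (by omega)
      have h3 := hν i
      rw [target_succ]
      have h4 : bead (-1) μ i = bead 0 μ 0 - i - 1 := by
        simp only [bead, h1]
        push_cast
        ring
      rw [h4, h2] at h3
      have h5 : bead 0 μ (i + 1) = bead 0 μ 0 - i - 1 := by omega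
      rw [h2, if_neg (by omega)]
      refine ⟨?_, rfl⟩
      simp only [bead] at h5
      omega
  have h1 := (isRegular_iff (by omega) μ).1 h 0
  rw [zero_add, (key (e - 1) (by omega)).1] at h1
  refine hμ (eq_bot_of_rowLen_zero ?_)
  omega

/-! ### The Mullineux map in terms of truncated `e`-rims -/

theorem card_bot : (⊥ : YoungDiagram).card = 0 := rfl

theorem removeColumn_bot : removeColumn ⊥ = ⊥ :=
  eq_bot_of_rowLen_zero (by rw [rowLen_removeColumn, rowLen_bot])

theorem removeTruncatedERim_bot (e : ℕ) [NeZero e] : removeTruncatedERim e ⊥ = ⊥ :=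
  eq_bot_of_rowLen_zero (Nat.le_zero.1 <| by
    simpa only [rowLen_bot] using rowLen_removeTruncatedERim_le e ⊥ 0)

theorem card_removeColumn_lt {μ : YoungDiagram} (h : μ ≠ ⊥) : (removeColumn μ).card < μ.card := by
  have h1 := card_removeColumn μ
  have h2 : 0 < μ.colLen 0 := by
    rw [lt_colLen_iff]
    exact Nat.pos_of_ne_zero fun h0 => h (eq_bot_of_rowLen_zero h0)
  omega

theorem card_removeTruncatedERim_lt {e : ℕ} [NeZero e] (he : 1 < e) {μ : YoungDiagram}
    (hr : IsRegular e μ) (h : μ ≠ ⊥) : (removeTruncatedERim e μ).card < μ.card := by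
  have h1 := truncatedRimSize_add e μ
  have h2 := truncatedRimSize_pos he hr h
  omega

theorem sum_truncatedRimSize_le (e : ℕ) [NeZero e] (μ : YoungDiagram) (n : ℕ) :
    ∑ a ∈ range n, truncatedRimSize e ((removeTruncatedERim e)^[a] μ) ≤ μ.card := by
  have h : ∑ a ∈ range n, truncatedRimSize e ((removeTruncatedERim e)^[a] μ) +
      ((removeTruncatedERim e)^[n] μ).card = μ.card := by
    induction n with
    | zero => simp
    | succ n ih =>
      rw [sum_range_succ, Function.iterate_succ_apply', add_assoc, truncatedRimSize_add, ih]
  omega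

theorem truncatedRimSize_iterate_antitone (e : ℕ) [NeZero e] (μ : YoungDiagram) :
    Antitone fun a => truncatedRimSize e ((removeTruncatedERim e)^[a] μ) :=
  antitone_nat_of_succ_le fun a => by
    rw [Function.iterate_succ_apply']
    exact (truncatedRimSize_removeTruncatedERim e _).1

/-- The partition whose parts are the sizes of the truncated `e`-rims that are removed from `μ`
successively. -/
noncomputable def truncatedRimPartition (e : ℕ) [NeZero e] (μ : YoungDiagram) : YoungDiagram :=
  ofRows (fun a => truncatedRimSize e ((removeTruncatedERim e)^[a] μ))
    (truncatedRimSize_iterate_antitone e μ)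
    ⟨μ.card, by
      by_contra h
      -- If the size at index `μ.card` were positive, so would be all earlier ones, and too many
      -- boxes would be removed.
      have h1 := sum_truncatedRimSize_le e μ (μ.card + 1)
      have h2 : ∑ _a ∈ range (μ.card + 1), 1 ≤
          ∑ a ∈ range (μ.card + 1), truncatedRimSize e ((removeTruncatedERim e)^[a] μ) :=
        sum_le_sum fun a ha => (Nat.one_le_iff_ne_zero.2 h).trans
          (truncatedRimSize_iterate_antitone e μ (Nat.lt_succ_iff.1 (mem_range.1 ha)))
      simp only [sum_const, card_range, smul_eq_mul, mul_one] at h2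
      omega⟩

/-- The conjugate of `truncatedRimPartition e μ`, which turns out to be the image of `μ` under the
Mullineux map. -/
noncomputable def truncatedMullineux (e : ℕ) [NeZero e] (μ : YoungDiagram) : YoungDiagram :=
  (truncatedRimPartition e μ).transpose

theorem colLen_truncatedMullineux (e : ℕ) [NeZero e] (μ : YoungDiagram) (a : ℕ) :
    (truncatedMullineux e μ).colLen a =
      truncatedRimSize e ((removeTruncatedERim e)^[a] μ) := by
  rw [truncatedMullineux, YoungDiagram.colLen_transpose]
  exact rowLen_ofRows _ _ _ _

theorem removeColumn_truncatedMullineux (e : ℕ) [NeZero e] (μ : YoungDiagram) :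
    removeColumn (truncatedMullineux e μ) = truncatedMullineux e (removeTruncatedERim e μ) :=
  ext_colLen fun a => by
    rw [colLen_removeColumn, colLen_truncatedMullineux, colLen_truncatedMullineux,
      Function.iterate_succ_apply]

theorem isRegular_truncatedMullineux (e : ℕ) [NeZero e] (μ : YoungDiagram) :
    IsRegular e (truncatedMullineux e μ) := by
  rw [isRegular_iff_colLen (Nat.pos_of_ne_zero (NeZero.ne e))]
  intro a
  rw [colLen_truncatedMullineux, colLen_truncatedMullineux, Function.iterate_succ_apply']
  exact (truncatedRimSize_removeTruncatedERim e _).2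

theorem truncatedMullineux_bot (e : ℕ) [NeZero e] : truncatedMullineux e ⊥ = ⊥ := by
  refine eq_bot_of_rowLen_zero (Nat.eq_zero_of_not_pos fun h => ?_)
  rw [← lt_colLen_iff, colLen_truncatedMullineux, Function.iterate_zero_apply] at h
  have := truncatedRimSize_add e ⊥
  rw [card_bot] at this
  omega

theorem card_truncatedMullineux {e : ℕ} [NeZero e] (he : 1 < e) {μ : YoungDiagram}
    (h : IsRegular e μ) : (truncatedMullineux e μ).card = μ.card := by
  induction hn : μ.card using Nat.strong_induction_on generalizing μ with
  | _ n ih =>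
    subst hn
    by_cases hμ : μ = ⊥
    · rw [hμ, truncatedMullineux_bot]
    · have h1 := ih _ (card_removeTruncatedERim_lt he h hμ) (isRegular_removeTruncatedERim h) rfl
      have h2 := card_removeColumn (truncatedMullineux e μ)
      rw [removeColumn_truncatedMullineux, h1, colLen_truncatedMullineux,
        Function.iterate_zero_apply] at h2
      have h3 := truncatedRimSize_add e μ
      omega

/-- As I = CJ, the `e`-rim accounts for the truncated `e`-rim and the first column of Jμ, which has
R - ε boxes. -/
theorem truncatedRimSize_eq (e : ℕ) [NeZero e] (μ : YoungDiagram) :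
    truncatedRimSize e μ + μ.colLen 0 =
      (eRim e μ).card + (if e ∣ (eRim e μ).card then 0 else 1) := by
  have h1 := colLen_removeTruncatedERim e μ
  have h2 := card_removeColumn (removeTruncatedERim e μ)
  have h3 := card_eRim e μ
  have h4 := truncatedRimSize_add e μ
  rw [removeERim_eq] at h3
  omega

/-- The dual of CX = XJ, which is the definition of X. Without first columns both sides agree: CJX =
JCX = JXJ = XCJ = XJC = CXC, by induction at Jμ. Both first columns have A - R boxes, by counting.
-/
theorem removeTruncatedERim_truncatedMullineux {e : ℕ} [NeZero e] (he : 1 < e) {μ : YoungDiagram}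
    (h : IsRegular e μ) :
    removeTruncatedERim e (truncatedMullineux e μ) = truncatedMullineux e (removeColumn μ) := by
  have he0 : 0 < e := by omega
  induction hn : μ.card using Nat.strong_induction_on generalizing μ with
  | _ n ih =>
    subst hn
    by_cases hμ : μ = ⊥
    · rw [hμ, removeColumn_bot, truncatedMullineux_bot, removeTruncatedERim_bot]
    · have hJ := isRegular_removeTruncatedERim h
      have h1 := ih _ (card_removeTruncatedERim_lt he h hμ) hJ rfl
      rw [← removeColumn_truncatedMullineux, removeTruncatedERim_removeColumn] at h1
      refine eq_of_removeColumn_eq ?_ ?_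
      · rw [h1, removeColumn_truncatedMullineux, removeTruncatedERim_removeColumn]
      · have hI : (removeERim e (truncatedMullineux e μ)).card = (removeERim e μ).card := by
          rw [removeERim_eq, h1, removeERim_eq,
            card_truncatedMullineux he (isRegular_removeColumn he0 hJ)]
        have hA : (eRim e (truncatedMullineux e μ)).card = (eRim e μ).card := by
          have h2 := card_eRim e (truncatedMullineux e μ)
          have h3 := card_eRim e μ
          rw [hI, card_truncatedMullineux he h] at h2
          omega
        have h4 := colLen_removeTruncatedERim e (truncatedMullineux e μ)
        have h5 := card_removeColumn (truncatedMullineux e (removeColumn μ))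
        have h6 := card_removeColumn μ
        have h7 := truncatedRimSize_eq e μ
        have h8 := card_eRim e μ
        rw [removeColumn_truncatedMullineux, removeTruncatedERim_removeColumn, ← removeERim_eq,
          card_truncatedMullineux he (by
            rw [removeERim_eq]; exact isRegular_removeColumn he0 hJ),
          card_truncatedMullineux he (isRegular_removeColumn he0 h)] at h5
        rw [hA, colLen_truncatedMullineux e μ, Function.iterate_zero_apply] at h4
        omega

theorem truncatedRimSize_truncatedMullineux {e : ℕ} [NeZero e] (he : 1 < e) {μ : YoungDiagram}
    (h : IsRegular e μ) : truncatedRimSize e (truncatedMullineux e μ) = μ.colLen 0 := by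
  have h1 := truncatedRimSize_add e (truncatedMullineux e μ)
  have h2 := card_removeColumn μ
  rw [removeTruncatedERim_truncatedMullineux he h, card_truncatedMullineux he h,
    card_truncatedMullineux he (isRegular_removeColumn (by omega) h)] at h1
  omega

/-- X exchanges C and J, so CXX = XJX = XXC, and induction applies to Cμ. -/
theorem truncatedMullineux_truncatedMullineux {e : ℕ} [NeZero e] (he : 1 < e) {μ : YoungDiagram}
    (h : IsRegular e μ) : truncatedMullineux e (truncatedMullineux e μ) = μ := by
  induction hn : μ.card using Nat.strong_induction_on generalizing μ with
  | _ n ih =>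
    subst hn
    by_cases hμ : μ = ⊥
    · rw [hμ, truncatedMullineux_bot, truncatedMullineux_bot]
    · refine eq_of_removeColumn_eq ?_ ?_
      · rw [removeColumn_truncatedMullineux, removeTruncatedERim_truncatedMullineux he h]
        exact ih _ (card_removeColumn_lt hμ) (isRegular_removeColumn (by omega) h) rfl
      · rw [colLen_truncatedMullineux, Function.iterate_zero_apply,
          truncatedRimSize_truncatedMullineux he h]

theorem isRegular_removeERim {e : ℕ} [NeZero e] {μ : YoungDiagram} (h : IsRegular e μ) :
    IsRegular e (removeERim e μ) := by
  rw [removeERim_eq]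
  exact isRegular_removeColumn (Nat.pos_of_ne_zero (NeZero.ne e)) (isRegular_removeTruncatedERim h)

theorem isRegular_iterate_removeERim {e : ℕ} [NeZero e] {μ : YoungDiagram} (h : IsRegular e μ)
    (i : ℕ) : IsRegular e ((removeERim e)^[i] μ) := by
  induction i with
  | zero => exact h
  | succ i ih =>
    rw [Function.iterate_succ_apply']
    exact isRegular_removeERim ih

theorem removeERim_truncatedMullineux {e : ℕ} [NeZero e] (he : 1 < e) {μ : YoungDiagram}
    (h : IsRegular e μ) :
    removeERim e (truncatedMullineux e μ) = truncatedMullineux e (removeERim e μ) := by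
  rw [removeERim_eq, removeTruncatedERim_truncatedMullineux he h, removeColumn_truncatedMullineux,
    removeTruncatedERim_removeColumn, removeERim_eq]

theorem iterate_removeERim_truncatedMullineux {e : ℕ} [NeZero e] (he : 1 < e) {μ : YoungDiagram}
    (h : IsRegular e μ) (i : ℕ) :
    (removeERim e)^[i] (truncatedMullineux e μ) = truncatedMullineux e ((removeERim e)^[i] μ) := by
  induction i with
  | zero => rfl
  | succ i ih =>
    rw [Function.iterate_succ_apply', ih, removeERim_truncatedMullineux he
      (isRegular_iterate_removeERim h i), Function.iterate_succ_apply']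

theorem card_eRim_truncatedMullineux {e : ℕ} [NeZero e] (he : 1 < e) {μ : YoungDiagram}
    (h : IsRegular e μ) : (eRim e (truncatedMullineux e μ)).card = (eRim e μ).card := by
  have h1 := card_eRim e (truncatedMullineux e μ)
  have h2 := card_eRim e μ
  rw [removeERim_truncatedMullineux he h, card_truncatedMullineux he h,
    card_truncatedMullineux he (isRegular_removeERim h)] at h1
  omega

theorem isMullineuxImage_truncatedMullineux {e : ℕ} [NeZero e] (he : 1 < e) {μ : YoungDiagram}
    (h : IsRegular e μ) : IsMullineuxImage e μ (truncatedMullineux e μ) := by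
  refine ⟨isRegular_truncatedMullineux e μ, fun i => ?_⟩
  have hi := isRegular_iterate_removeERim h i
  rw [rimSize, rimLength, iterate_removeERim_truncatedMullineux he h,
    card_eRim_truncatedMullineux he hi, colLen_truncatedMullineux, Function.iterate_zero_apply]
  refine ⟨rfl, ?_⟩
  have h1 := truncatedRimSize_eq e ((removeERim e)^[i] μ)
  rw [rimSize, rimLength]
  split_ifs at h1 ⊢ <;> omega

/-- An `e`-regular partition is determined by its Mullineux symbol. -/
theorem eq_of_mullineuxSymbol_eq {e : ℕ} [NeZero e] (he : 1 < e) {μ ν : YoungDiagram}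
    (hμ : IsRegular e μ) (hν : IsRegular e ν) (hA : ∀ i, rimSize e μ i = rimSize e ν i)
    (hR : ∀ i, rimLength e μ i = rimLength e ν i) : μ = ν := by
  induction hn : μ.card using Nat.strong_induction_on generalizing μ ν with
  | _ n ih =>
    subst hn
    have hR0 : μ.colLen 0 = ν.colLen 0 := hR 0
    have hA0 : (eRim e μ).card = (eRim e ν).card := hA 0
    by_cases h0 : μ = ⊥
    · subst h0
      refine (eq_bot_of_rowLen_zero (Nat.eq_zero_of_not_pos fun h1 => ?_)).symm
      rw [← lt_colLen_iff, ← hR0, lt_colLen_iff, rowLen_bot] at h1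
      exact lt_irrefl _ h1
    · have hlt : (removeERim e μ).card < μ.card := by
        rw [removeERim_eq]
        have h1 := card_removeColumn (removeTruncatedERim e μ)
        have h2 := card_removeTruncatedERim_lt he hμ h0
        omega
      have hI := ih _ hlt (isRegular_removeERim hμ) (isRegular_removeERim hν)
        (fun i => hA (i + 1)) (fun i => hR (i + 1)) rfl
      -- Induction gives Iμ = Iν, that is, CJμ = CJν; the lost first column has R - ε boxes.
      have hJ : removeTruncatedERim e μ = removeTruncatedERim e ν := by
        refine eq_of_removeColumn_eq ?_ ?_
        · rw [← removeERim_eq, hI, removeERim_eq]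
        · have h1 := colLen_removeTruncatedERim e μ
          have h2 := colLen_removeTruncatedERim e ν
          rw [hA0] at h1
          omega
      -- J need not be inverted directly: under the involution X it becomes C, whose inverse needs
      -- only the first column A - R + ε.
      rw [← truncatedMullineux_truncatedMullineux he hμ,
        ← truncatedMullineux_truncatedMullineux he hν]
      congr 1
      refine eq_of_removeColumn_eq ?_ ?_
      · rw [removeColumn_truncatedMullineux, removeColumn_truncatedMullineux, hJ]
      · simp only [colLen_truncatedMullineux, Function.iterate_zero_apply]
        have h1 := truncatedRimSize_eq e μ
        have h2 := truncatedRimSize_eq e ν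
        rw [hA0] at h1
        omega

theorem existsUnique_isMullineuxImage {e : ℕ} [NeZero e] (he : 1 < e) {μ : YoungDiagram}
    (h : IsRegular e μ) : ∃! ν, IsMullineuxImage e μ ν := by
  refine ⟨_, isMullineuxImage_truncatedMullineux he h, fun ν hν => ?_⟩
  have h1 := isMullineuxImage_truncatedMullineux he h
  refine eq_of_mullineuxSymbol_eq he hν.1 h1.1 (fun i => ?_) fun i => ?_
  · rw [(hν.2 i).1, (h1.2 i).1]
  · exact Int.ofNat_inj.1 ((hν.2 i).2.trans (h1.2 i).2.symm)

theorem mullineux_eq {e : ℕ} [NeZero e] (he : 1 < e) {μ : YoungDiagram} (h : IsRegular e μ) :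
    mullineux e μ = truncatedMullineux e μ := by
  have h1 := isMullineuxImage_truncatedMullineux he h
  exact (existsUnique_isMullineuxImage he h).unique (Classical.epsilon_spec ⟨_, h1⟩) h1

/-! ### The algorithm -/

/-- The inserted bead is the one of the first part; dropping this part moves the others up a row,
which offsets the shift s - 1. -/
theorem insert_ms_betaSet (e : ℕ) [NeZero e] (s : ℤ) (μ : YoungDiagram) :
    insert (ms e (betaSet s μ))
        (betaSet (s - 1) (truncatedMullineux e (removeTruncatedERim e μ)).transpose) =
      betaSet s (truncatedMullineux e μ).transpose := by
  rw [ms_betaSet]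
  ext x
  simp only [betaSet, Set.mem_insert_iff, Set.mem_range, YoungDiagram.rowLen_transpose,
    colLen_truncatedMullineux]
  constructor
  · rintro (rfl | ⟨i, rfl⟩)
    · exact ⟨0, by simp⟩
    · refine ⟨i + 1, ?_⟩
      rw [Function.iterate_succ_apply]
      push_cast
      ring
  · rintro ⟨_ | i, rfl⟩
    · exact Or.inl (by simp)
    · refine Or.inr ⟨i, ?_⟩
      rw [Function.iterate_succ_apply]
      push_cast
      ring

/-- The induction needs arbitrary s and T, as each round lowers s by one and enlarges T. -/
theorem returns_betaSet {e : ℕ} [NeZero e] (he : 1 < e) {μ : YoungDiagram} (h : IsRegular e μ)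
    (s : ℤ) (T : Set ℤ) :
    Returns e (betaSet s μ) T (T ∪ betaSet s (truncatedMullineux e μ).transpose) := by
  induction hn : μ.card using Nat.strong_induction_on generalizing μ s T with
  | _ n ih =>
    subst hn
    by_cases hμ : μ = ⊥
    · have hbot : (⊥ : YoungDiagram).transpose = ⊥ :=
        eq_bot_of_rowLen_zero (by
          rw [YoungDiagram.rowLen_transpose, ← Nat.le_zero, ← not_lt, lt_colLen_iff, rowLen_bot]
          exact lt_irrefl 0)
      rw [hμ, truncatedMullineux_bot, hbot]
      exact Returns.done _ _ ⟨s, rfl⟩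
    · refine Returns.step _ _ _ (fun h0 => hμ ((isBetaSet_bot_iff s μ).1 h0)) ?_
      rw [Ms_betaSet, ← insert_ms_betaSet, Set.union_insert, ← Set.insert_union]
      exact ih _ (card_removeTruncatedERim_lt he h hμ) (isRegular_removeTruncatedERim h) _ _ rfl

end AbacusMullineux

theorem mainTheorem6 (e : ℕ) [NeZero e] (he : 2 < e) (lam : YoungDiagram)
    (hlam : AbacusMullineux.IsRegular e lam) :
    (∃! μ, AbacusMullineux.IsMullineuxImage e lam μ) ∧
    ∀ B : Set ℤ, AbacusMullineux.IsBetaSet B lam →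
      ∃ R : Set ℤ, AbacusMullineux.Returns e B ∅ R ∧
        AbacusMullineux.IsBetaSet R (AbacusMullineux.mullineux e lam).transpose ∧
        (B = AbacusMullineux.betaSet 0 lam →
          R = AbacusMullineux.betaSet 0 (AbacusMullineux.mullineux e lam).transpose) := by
  have he1 : 1 < e := by omega
  refine ⟨AbacusMullineux.existsUnique_isMullineuxImage he1 hlam, ?_⟩
  rintro _ ⟨s, rfl⟩
  have h := AbacusMullineux.returns_betaSet he1 hlam s ∅
  rw [Set.empty_union, ← AbacusMullineux.mullineux_eq he1 hlam] at h
  refine ⟨_, h, ⟨s, rfl⟩, fun h0 => ?_⟩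
  rw [(AbacusMullineux.betaSet_injective h0).1]
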